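/- Let $d\ge 1$, let $\psi:[0,\infty)\to[0,\infty)$ be an increasing (i.e. non-decreasing) function with $\lim_{r\to\infty}\psi(r)=\infty$, and let $\|\cdot\|$ be the Euclidean norm on $\mathbb R^d$. Let $$C_\psi(\mathbb R^d)=\Big\{\phi:\mathbb R^d\to\mathbb C \;:\; \phi \text{ is continuous and } \lim_{\|x\|\to\infty}\frac{\phi(x)}{e^{\psi(\|x\|)}}=0\Big\},\qquad \|\phi\|_\psi=\sup_{x\in\mathbb R^d}\frac{|\phi(x)|}{e^{\psi(\|x\|)}}.$$ For $L>0$ let $Q(0,L)=\{\lambda\in\mathbb R^d : |\lambda_j|<L/\sqrt d,\ 1\le j\le d\}$, let $e_\lambda(x)=e^{i\lambda\cdot x}$, and let $\Phi_L(\mathbb R^d)$ be the complex linear span of $\{e_\lambda:\lambda\in Q(0,L)\}$. If $$\int_1^\infty\frac{\psi(r)}{r^2}\,dr=\infty,$$ then for every $L>0$ the space $\Phi_L(\mathbb R^d)$ is contained in $C_\psi(\mathbb R^d)$ and is dense in the normed space $(C_\psi(\mathbb R^d),\|\cdot\|_\psi)$. -/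

import Mathlib

open scoped NNReal ENNReal
open Filter Topology MeasureTheory

noncomputable section

/-- The continuous functions `φ : ℝ^d → ℂ` with `φ(x) / e^{ψ(‖x‖)} → 0` as `‖x‖ → ∞`, as a complex
subspace of the space of all functions. -/
def weightedSubmodule (d : ℕ) (ψ : ℝ≥0 → ℝ≥0) :
    Submodule ℂ (EuclideanSpace ℝ (Fin d) → ℂ) where
  carrier := {φ | Continuous φ ∧
    Tendsto (fun x => φ x / (Real.exp (ψ ‖x‖₊) : ℂ))
      (Bornology.cobounded (EuclideanSpace ℝ (Fin d))) (𝓝 0)}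
  add_mem' := by
    rintro f g ⟨hf, hf'⟩ ⟨hg, hg'⟩
    refine ⟨hf.add hg, ?_⟩
    simpa [add_div] using hf'.add hg'
  zero_mem' := ⟨continuous_const, by simpa using tendsto_const_nhds⟩
  smul_mem' := by
    rintro c f ⟨hf, hf'⟩
    refine ⟨hf.const_smul c, ?_⟩
    simpa [mul_div_assoc] using hf'.const_mul c

/-- The space `C_ψ(ℝ^d)`. It is a type of its own, so that its only topology is the one that comes
from the weighted norm below (a subtype of a function space would also carry the topology of
pointwise convergence). -/
def WeightedSpace (d : ℕ) (ψ : ℝ≥0 → ℝ≥0) : Type := ↥(weightedSubmodule d ψ)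

namespace WeightedSpace

variable {d : ℕ} {ψ : ℝ≥0 → ℝ≥0}

instance : AddCommGroup (WeightedSpace d ψ) :=
  inferInstanceAs (AddCommGroup ↥(weightedSubmodule d ψ))

instance : Module ℂ (WeightedSpace d ψ) :=
  inferInstanceAs (Module ℂ ↥(weightedSubmodule d ψ))

/-- The inclusion of `C_ψ(ℝ^d)` in the space of all functions `ℝ^d → ℂ`. -/
def toFunₗ (d : ℕ) (ψ : ℝ≥0 → ℝ≥0) :
    WeightedSpace d ψ →ₗ[ℂ] (EuclideanSpace ℝ (Fin d) → ℂ) :=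
  (weightedSubmodule d ψ).subtype

/-- The norm `‖φ‖_ψ = sup_x |φ(x)| / e^{ψ(‖x‖)}`. -/
instance : Norm (WeightedSpace d ψ) where
  norm φ := ⨆ x : EuclideanSpace ℝ (Fin d), ‖toFunₗ d ψ φ x‖ / Real.exp (ψ ‖x‖₊)

theorem norm_def (φ : WeightedSpace d ψ) :
    ‖φ‖ = ⨆ x : EuclideanSpace ℝ (Fin d), ‖toFunₗ d ψ φ x‖ / Real.exp (ψ ‖x‖₊) := rfl

/-- The supremum that defines the norm is finite. -/
theorem bddAbove (φ : WeightedSpace d ψ) :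
    BddAbove (Set.range fun x : EuclideanSpace ℝ (Fin d) =>
      ‖toFunₗ d ψ φ x‖ / Real.exp (ψ ‖x‖₊)) := by
  have hc : Continuous (toFunₗ d ψ φ) := φ.2.1
  have ht : Tendsto (fun x => toFunₗ d ψ φ x / (Real.exp (ψ ‖x‖₊) : ℂ))
      (Bornology.cobounded (EuclideanSpace ℝ (Fin d))) (𝓝 0) := φ.2.2
  have h1 : ∀ᶠ x in Bornology.cobounded (EuclideanSpace ℝ (Fin d)),
      ‖toFunₗ d ψ φ x‖ / Real.exp (ψ ‖x‖₊) < 1 := by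
    have := (tendsto_zero_iff_norm_tendsto_zero.1 ht).eventually (gt_mem_nhds one_pos)
    filter_upwards [this] with x hx
    rwa [norm_div, Complex.norm_real, Real.norm_of_nonneg (Real.exp_pos _).le] at hx
  rw [Metric.cobounded_eq_cocompact, Filter.hasBasis_cocompact.eventually_iff] at h1
  obtain ⟨K, hK, hK'⟩ := h1
  obtain ⟨C, hC⟩ := hK.exists_bound_of_continuousOn hc.continuousOn
  refine ⟨max C 1, ?_⟩
  rintro _ ⟨x, rfl⟩
  by_cases hx : x ∈ K
  · refine le_trans ?_ ((hC x hx).trans (le_max_left _ _))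
    exact div_le_self (norm_nonneg _) (Real.one_le_exp (ψ ‖x‖₊).2)
  · exact (hK' hx).le.trans (le_max_right _ _)

theorem le_norm (φ : WeightedSpace d ψ) (x : EuclideanSpace ℝ (Fin d)) :
    ‖toFunₗ d ψ φ x‖ / Real.exp (ψ ‖x‖₊) ≤ ‖φ‖ :=
  le_ciSup (bddAbove φ) x

theorem core : NormedSpace.Core ℂ (WeightedSpace d ψ) where
  norm_nonneg φ := Real.iSup_nonneg fun x => by positivity
  norm_smul c φ := by
    simp only [norm_def, map_smul, Pi.smul_apply, norm_smul, mul_div_assoc]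
    exact (Real.mul_iSup_of_nonneg (norm_nonneg c) _).symm
  norm_triangle f g := by
    refine ciSup_le fun x => ?_
    refine le_trans ?_ (add_le_add (le_norm f x) (le_norm g x))
    rw [← add_div, map_add, Pi.add_apply]
    gcongr
    exact norm_add_le _ _
  norm_eq_zero_iff φ := by
    constructor
    · intro h
      have h0 : toFunₗ d ψ φ = 0 := by
        funext x
        have hx := le_norm φ x
        rw [h, div_le_iff₀ (Real.exp_pos _), zero_mul] at hx
        exact norm_le_zero_iff.1 hx
      exact Subtype.ext h0
    · rintro rfl
      simp [norm_def]

/-- `(C_ψ(ℝ^d), ‖·‖_ψ)` is a normed linear space. -/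
instance : NormedAddCommGroup (WeightedSpace d ψ) := NormedAddCommGroup.ofCore core

instance : NormedSpace ℂ (WeightedSpace d ψ) := NormedSpace.ofCore core

end WeightedSpace

/-- The open cube `Q(0,L)` in `ℝ^d`, centred at the origin, of side length `2L/√d`. -/
def openCube (d : ℕ) (L : ℝ) : Set (EuclideanSpace ℝ (Fin d)) :=
  {x | ∀ j, |x j| < L / √(d : ℝ)}

/-- The exponential `e_λ(x) = e^{i λ·x}`. -/
def expFun {d : ℕ} (l : EuclideanSpace ℝ (Fin d)) : EuclideanSpace ℝ (Fin d) → ℂ :=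
  fun x => Complex.exp (Complex.I * (inner ℝ l x : ℝ))

/-- `Φ_L(ℝ^d)`, the complex linear span of the `e_λ` with `λ ∈ Q(0,L)`. -/
def expSpan (d : ℕ) (L : ℝ) : Submodule ℂ (EuclideanSpace ℝ (Fin d) → ℂ) :=
  Submodule.span ℂ (expFun '' openCube d L)

end

/-!
A seminorm `p ≤ ‖·‖_ψ` that vanishes on the `e_λ` with `λ` in a ball vanishes on all of them. Indeed
the `m`-th difference of `λ ↦ e_λ` with step `u` is `e_λ (e_u - 1) ^ m`, whose norm is at most
`(‖u‖ R) ^ m + 2 ^ m e ^ (-ψ(R))` for every `R`, so extrapolation with `n ≈ ψ(R)` nodes spaced by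
`‖u‖ ≈ 1 / R` carries smallness `e ^ (-c n)` of `p(e_λ)` on a ball to smallness `e ^ (-c n / 4)` on
a ball whose radius is larger by about `ψ(R) / R`. Along radii with `ψ(R_k) ≈ 4 ^ k` the gains sum
to `∑ 4 ^ k / R_k`, which diverges exactly because `∫ ψ(r) / r ^ 2 dr` does. With `p` the distance
to `Φ_L` this puts all exponentials into the closure of `Φ_L`, and these span a dense subspace: a
`φ` in `C_ψ` is close to its composition with triangle waves of a large period in each coordinate,
which is periodic and hence a uniform limit of trigonometric polynomials.
-/

section FiniteDifferences

open fwdDiff_aux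

variable {M G : Type*} [AddCommMonoid M] [AddCommGroup G]

theorem eq_sum_choose_smul_fwdDiff_iter (h : M) (f : M → G) (N : ℕ) (y : M) :
    f y = ∑ k ∈ Finset.range (N + 1),
      ((-1 : ℤ) ^ (N - k) * N.choose k) • (fwdDiff h)^[N - k] f (y + k • h) := by
  have hone : shiftₗ M G h + -fwdDiffₗ M G h = 1 := by simp [shiftₗ]
  have hcomm : Commute (shiftₗ M G h) (-fwdDiffₗ M G h) :=
    ((Commute.refl _).add_left (Commute.one_left _)).neg_right
  have hpow := congr_fun (LinearMap.congr_fun (hcomm.add_pow N) f) y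
  rw [hone, one_pow, Module.End.one_apply, LinearMap.sum_apply, Finset.sum_apply] at hpow
  refine hpow.trans (Finset.sum_congr rfl fun k _ => ?_)
  have hcoeff : (-fwdDiffₗ M G h) ^ (N - k) * (N.choose k : Module.End ℤ (M → G)) =
      ((-1 : ℤ) ^ (N - k) * N.choose k) • fwdDiffₗ M G h ^ (N - k) := by
    rw [zsmul_eq_mul, neg_pow, mul_assoc, ← Nat.cast_comm]
    push_cast
    rw [mul_assoc]
  rw [mul_assoc, hcoeff, Module.End.mul_apply, shiftₗ_pow_apply, LinearMap.smul_apply,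
    Pi.smul_apply, coe_fwdDiffₗ_pow]

variable {𝕜 : Type*} [RCLike 𝕜] [Module 𝕜 G]

theorem seminorm_fwdDiff_iter_le (p : Seminorm 𝕜 G) (f : M → G) (h y : M) (m : ℕ) {B : ℝ}
    (hB : ∀ k ≤ m, p (f (y + k • h)) ≤ B) : p ((fwdDiff h)^[m] f y) ≤ 2 ^ m * B := by
  induction m generalizing y with
  | zero => simpa using hB 0 le_rfl
  | succ m ih =>
    have h₀ := ih y fun k hk => hB k (by lia)
    have h₁ := ih (y + h) fun k hk => by
      simpa only [add_assoc, succ_nsmul'] using hB (k + 1) (by lia)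
    rw [Function.iterate_succ_apply', fwdDiff]
    calc p ((fwdDiff h)^[m] f (y + h) - (fwdDiff h)^[m] f y)
        ≤ p ((fwdDiff h)^[m] f (y + h)) + p ((fwdDiff h)^[m] f y) := map_sub_le_add p _ _
      _ ≤ 2 ^ (m + 1) * B := by rw [pow_succ]; linarith

theorem seminorm_le_of_fwdDiff_iter_le (p : Seminorm 𝕜 G) (f : M → G) (h y : M) {n : ℕ}
    {B D : ℝ} (hD : ∀ k ≤ n, p ((fwdDiff h)^[2 * n - k] f (y + k • h)) ≤ D)
    (hB : ∀ k, n ≤ k → k ≤ 2 * n → p (f (y + k • h)) ≤ B) :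
    p (f y) ≤ 4 ^ n * (D + 2 ^ n * B) := by
  have hD₀ : 0 ≤ D := (apply_nonneg p _).trans (hD 0 n.zero_le)
  have hB₀ : 0 ≤ B := (apply_nonneg p _).trans (hB n le_rfl (by lia))
  have hdiff : ∀ k ≤ 2 * n, p ((fwdDiff h)^[2 * n - k] f (y + k • h)) ≤ D + 2 ^ n * B := by
    intro k hk
    rcases le_total k n with hkn | hnk
    · exact (hD k hkn).trans (le_add_of_nonneg_right (by positivity))
    · calc p ((fwdDiff h)^[2 * n - k] f (y + k • h)) ≤ 2 ^ (2 * n - k) * B :=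
            seminorm_fwdDiff_iter_le p f h _ _ fun i hi => by
              simpa only [add_assoc, add_nsmul] using hB (k + i) (by lia) (by lia)
        _ ≤ 2 ^ n * B := by gcongr <;> [norm_num; lia]
        _ ≤ D + 2 ^ n * B := le_add_of_nonneg_left hD₀
  calc p (f y) ≤ ∑ k ∈ Finset.range (2 * n + 1),
        p (((-1 : ℤ) ^ (2 * n - k) * (2 * n).choose k) •
          (fwdDiff h)^[2 * n - k] f (y + k • h)) := by
        conv_lhs => rw [eq_sum_choose_smul_fwdDiff_iter h f (2 * n) y]
        exact Finset.le_sum_of_subadditive p (map_zero p).le (map_add_le_add p) _ _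
    _ ≤ ∑ k ∈ Finset.range (2 * n + 1), ((2 * n).choose k : ℝ) * (D + 2 ^ n * B) := by
        refine Finset.sum_le_sum fun k hk => ?_
        rw [← Int.cast_smul_eq_zsmul 𝕜, map_smul_eq_mul]
        push_cast
        rw [norm_mul, norm_pow, norm_neg, norm_one, one_pow, one_mul, RCLike.norm_natCast]
        gcongr
        exact hdiff k (by simpa [Nat.lt_succ_iff] using hk)
    _ = 4 ^ n * (D + 2 ^ n * B) := by
        rw [← Finset.sum_mul, ← Nat.cast_sum, Nat.sum_range_choose, pow_mul]
        norm_num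

end FiniteDifferences

theorem exists_norm_le_forall_add_nsmul_mem_closedBall {E : Type*} [SeminormedAddCommGroup E]
    [NormedSpace ℝ E] {c l : E} {ρ σ : ℝ} (hρ : 0 < ρ) (hσ : 0 ≤ σ) (hσρ : σ ≤ 2 * ρ)
    (hl : l ∈ Metric.closedBall c (ρ + σ)) {n : ℕ} (hn : n ≠ 0) :
    ∃ u : E, ‖u‖ ≤ σ / n ∧ ∀ k, n ≤ k → k ≤ 2 * n → l + k • u ∈ Metric.closedBall c ρ := by
  rw [mem_closedBall_iff_norm] at hl
  have hρσ : 0 < ρ + σ := by positivity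
  obtain ⟨t, ht₀, ht⟩ : ∃ t, 0 ≤ t ∧ t * (ρ + σ) = σ :=
    ⟨σ / (ρ + σ), by positivity, div_mul_cancel₀ _ hρσ.ne'⟩
  refine ⟨(-(t / n)) • (l - c), ?_, fun k hnk hkn => ?_⟩
  · rw [norm_smul, norm_neg, Real.norm_of_nonneg (by positivity), div_mul_eq_mul_div]
    gcongr
    exact (mul_le_mul_of_nonneg_left hl ht₀).trans_eq ht
  · have hlower : t ≤ k * (t / n) := by
      calc t = n * (t / n) := by field_simp
        _ ≤ k * (t / n) := by gcongr
    have hupper : k * (t / n) ≤ 2 * t := by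
      calc k * (t / n) ≤ (2 * n : ℕ) * (t / n) := by gcongr
        _ = 2 * t := by push_cast; field_simp
    have hcontr : |1 - k * (t / n)| * (ρ + σ) ≤ ρ := by
      nth_rw 1 [← abs_of_pos hρσ]
      rw [← abs_mul, abs_le]
      constructor <;> nlinarith
    have hsub : l + k • (-(t / n)) • (l - c) - c = (1 - k * (t / n)) • (l - c) := by module
    rw [mem_closedBall_iff_norm, hsub, norm_smul, Real.norm_eq_abs]
    exact (mul_le_mul_of_nonneg_left hl (abs_nonneg _)).trans hcontr

section IntegralCondition

variable {ψ : ℝ≥0 → ℝ≥0}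

theorem lintegral_Ioi_const_div_sq {c K : ℝ} (hc : 0 < c) (hK : 0 ≤ K) :
    ∫⁻ r in Set.Ioi c, ENNReal.ofReal (K / r ^ 2) = ENNReal.ofReal (K / c) := by
  have heq : Set.EqOn (fun r : ℝ => K / r ^ 2) (fun r => K * r ^ (-2 : ℝ)) (Set.Ioi c) :=
    fun r hr => by
      simp only [Real.rpow_neg (hc.trans hr).le, Real.rpow_ofNat, div_eq_mul_inv]
  have hint : IntegrableOn (fun r : ℝ => K / r ^ 2) (Set.Ioi c) :=
    IntegrableOn.congr_fun ((integrableOn_Ioi_rpow_of_lt (by norm_num) hc).const_mul K) heq.symm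
      measurableSet_Ioi
  rw [← ofReal_integral_eq_lintegral_ofReal hint (ae_of_all _ fun r => by positivity),
    setIntegral_congr_fun measurableSet_Ioi heq, integral_const_mul,
    integral_Ioi_rpow_of_lt (by norm_num) hc]
  norm_num [Real.rpow_neg_one, div_eq_mul_inv]

theorem tendsto_atTop_of_lintegral_div_sq_eq_top (hψ_mono : Monotone ψ)
    (hψ_int : ∫⁻ r in Set.Ioi (1 : ℝ), ENNReal.ofReal ((ψ r.toNNReal : ℝ) / r ^ 2) = ⊤) :
    Tendsto ψ atTop atTop := by
  refine tendsto_atTop_atTop_of_monotone hψ_mono fun b => ?_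
  by_contra! hb
  have hle : ∫⁻ r in Set.Ioi (1 : ℝ), ENNReal.ofReal ((ψ r.toNNReal : ℝ) / r ^ 2) ≤
      ∫⁻ r in Set.Ioi (1 : ℝ), ENNReal.ofReal ((b : ℝ) / r ^ 2) := by
    refine lintegral_mono fun r => ENNReal.ofReal_le_ofReal ?_
    gcongr
    exact (hb _).le
  rw [hψ_int, lintegral_Ioi_const_div_sq one_pos b.coe_nonneg, top_le_iff] at hle
  exact ENNReal.ofReal_ne_top hle

theorem ofReal_div_sq_le_add_tsum_indicator {b q : ℝ≥0} (hb : 0 < b) (hq : 1 < q) {c : ℕ → ℝ}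
    {r : ℝ} {y : ℝ≥0} (hc : ∀ k, b * q ^ k ≤ y → c k < r) :
    ENNReal.ofReal (y / r ^ 2) ≤ ENNReal.ofReal (b / r ^ 2) +
      ∑' k, (Set.Ioi (c k)).indicator
        (fun r : ℝ => ENNReal.ofReal ((b * q ^ (k + 1) : ℝ≥0) / r ^ 2)) r := by
  rcases le_total y b with hyb | hby
  · exact (ENNReal.ofReal_le_ofReal (by gcongr)).trans le_self_add
  · obtain ⟨k, hk, hk'⟩ := exists_nat_pow_near ((one_le_div hb).2 hby) hq
    rw [le_div_iff₀' hb] at hk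
    rw [div_lt_iff₀' hb] at hk'
    refine le_trans ?_ ((ENNReal.le_tsum k).trans le_add_self)
    rw [Set.indicator_of_mem (show r ∈ Set.Ioi (c k) from hc k hk)]
    gcongr

theorem lintegral_div_sq_ne_top_of_summable {b q : ℝ≥0} (hb : 0 < b) (hq : 1 < q) {c : ℕ → ℝ}
    (hc₀ : ∀ k, 0 < c k) (hc : ∀ k, ∀ r : ℝ≥0, 1 < r → b * q ^ k ≤ ψ r → c k < r)
    (hsum : Summable fun k => (q : ℝ) ^ k / c k) :
    ∫⁻ r in Set.Ioi (1 : ℝ), ENNReal.ofReal ((ψ r.toNNReal : ℝ) / r ^ 2) ≠ ⊤ := by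
  set G : ℕ → ℝ → ℝ≥0∞ := fun k => (Set.Ioi (c k)).indicator
    fun r => ENNReal.ofReal ((b * q ^ (k + 1) : ℝ≥0) / r ^ 2)
  have hG : ∀ k, Measurable (G k) := fun k => Measurable.indicator (by fun_prop) measurableSet_Ioi
  have hpointwise : ∀ r ∈ Set.Ioi (1 : ℝ), ENNReal.ofReal ((ψ r.toNNReal : ℝ) / r ^ 2) ≤
      ENNReal.ofReal (b / r ^ 2) + ∑' k, G k r := fun r hr =>
    ofReal_div_sq_le_add_tsum_indicator hb hq fun k hk =>
      (hc k _ (Real.one_lt_toNNReal.2 hr) hk).trans_eq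
        (Real.coe_toNNReal r (zero_le_one.trans (le_of_lt hr)))
  have hGsum : ∑' k, ∫⁻ r in Set.Ioi (1 : ℝ), G k r ≤
      ∑' k, ENNReal.ofReal (b * q * (q ^ k / c k)) := by
    refine ENNReal.tsum_le_tsum fun k => (setLIntegral_le_lintegral _ _).trans_eq ?_
    rw [lintegral_indicator measurableSet_Ioi, lintegral_Ioi_const_div_sq (hc₀ k) (by positivity)]
    push_cast
    ring_nf
  refine ne_top_of_le_ne_top ?_ (setLIntegral_mono' measurableSet_Ioi hpointwise)
  rw [lintegral_add_left (by fun_prop), lintegral_Ioi_const_div_sq one_pos b.coe_nonneg,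
    lintegral_tsum fun k => (hG k).aemeasurable]
  exact ENNReal.add_ne_top.2 ⟨ENNReal.ofReal_ne_top,
    ne_top_of_le_ne_top (hsum.mul_left _).tsum_ofReal_ne_top hGsum⟩

theorem exists_seq_le_not_summable_pow_div (hψ_mono : Monotone ψ)
    (hψ_int : ∫⁻ r in Set.Ioi (1 : ℝ), ENNReal.ofReal ((ψ r.toNNReal : ℝ) / r ^ 2) = ⊤)
    {b q : ℝ≥0} (hb : 0 < b) (hq : 1 < q) :
    ∃ R : ℕ → ℝ≥0, (∀ k, b * q ^ k ≤ ψ (R k)) ∧ ¬ Summable fun k => (q : ℝ) ^ k / R k := by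
  have hψ := tendsto_atTop_of_lintegral_div_sq_eq_top hψ_mono hψ_int
  set ρ : ℕ → ℝ≥0 := fun k => sInf {r | b * q ^ k ≤ ψ r}
  refine ⟨fun k => ρ k + 1, fun k => ?_, fun hsum => ?_⟩
  · obtain ⟨r, hr, hrρ⟩ := exists_lt_of_csInf_lt (hψ.eventually_ge_atTop (b * q ^ k)).exists
      (lt_add_one (ρ k))
    exact le_trans hr (hψ_mono hrρ.le)
  · refine lintegral_div_sq_ne_top_of_summable hb hq (c := fun k => ((ρ k + 1 : ℝ≥0) : ℝ) / 2)
      (fun k => by positivity) (fun k r hr hk => ?_) ((hsum.mul_left 2).congr fun k => ?_) hψ_int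
    · have hρr : ρ k ≤ r := csInf_le' hk
      have : (ρ k : ℝ) ≤ r := hρr
      have : (1 : ℝ) < r := hr
      push_cast
      linarith
    · field_simp

theorem not_summable_min_const {f : ℕ → ℝ} {a : ℝ} (ha : 0 < a) (hf : ¬ Summable f) :
    ¬ Summable fun k => min (f k) a := by
  intro hsum
  refine hf ((summable_congr_atTop ?_).1 hsum)
  filter_upwards [hsum.tendsto_atTop_zero.eventually_lt_const ha] with k hk
  exact min_eq_left ((min_lt_iff.1 hk).resolve_right (lt_irrefl a)).le

end IntegralCondition

theorem exp_neg_le_inv_sixtyFour_pow {y : ℝ} {n : ℕ} (hy : 5 * n ≤ y) :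
    Real.exp (-y) ≤ 64⁻¹ ^ n := by
  have h64 : (64 : ℝ) ≤ Real.exp 5 := by
    calc (64 : ℝ) ≤ 2.7 ^ 5 := by norm_num
      _ ≤ Real.exp 1 ^ 5 := by
          gcongr
          exact le_trans (by norm_num) Real.exp_one_gt_d9.le
      _ = Real.exp 5 := by rw [← Real.exp_nat_mul]; norm_num
  rw [Real.exp_neg, inv_pow]
  gcongr
  calc (64 : ℝ) ^ n ≤ Real.exp 5 ^ n := by gcongr
    _ = Real.exp (5 * n) := by rw [← Real.exp_nat_mul, mul_comm]
    _ ≤ Real.exp y := Real.exp_le_exp.2 hy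

section Exponentials

variable {d : ℕ}

theorem norm_expFun (l x : EuclideanSpace ℝ (Fin d)) : ‖expFun l x‖ = 1 := by
  rw [expFun, mul_comm, Complex.norm_exp_ofReal_mul_I]

theorem continuous_expFun (l : EuclideanSpace ℝ (Fin d)) : Continuous (expFun l) := by
  unfold expFun
  fun_prop

theorem expFun_add (l m : EuclideanSpace ℝ (Fin d)) : expFun (l + m) = expFun l * expFun m := by
  funext x
  simp only [expFun, Pi.mul_apply, ← Complex.exp_add, inner_add_left, Complex.ofReal_add, mul_add]

theorem norm_expFun_sub_one_le_two (l x : EuclideanSpace ℝ (Fin d)) : ‖expFun l x - 1‖ ≤ 2 := by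
  refine (norm_sub_le _ _).trans_eq ?_
  rw [norm_expFun, norm_one, one_add_one_eq_two]

theorem norm_expFun_sub_one_le (l x : EuclideanSpace ℝ (Fin d)) :
    ‖expFun l x - 1‖ ≤ ‖l‖ * ‖x‖ :=
  Real.norm_exp_I_mul_ofReal_sub_one_le.trans (norm_inner_le_norm l x)

theorem openCube_mem_nhds_zero {L : ℝ} (hL : 0 < L) : openCube d L ∈ 𝓝 0 := by
  refine eventually_all.2 fun j => ?_
  have hd : (0 : ℝ) < d := by exact_mod_cast j.pos
  have hcont : Continuous fun x : EuclideanSpace ℝ (Fin d) => |x j| := by fun_prop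
  exact hcont.continuousAt.eventually_lt_const (by simpa using by positivity)

end Exponentials

section TriangleWave

variable {d : ℕ}

/-- The covering map of the torus by `ℝ^d` for which functions on the torus pull back to functions
with period `2πs` in each coordinate. -/
noncomputable def torusProj (s : ℝ) (x : EuclideanSpace ℝ (Fin d)) : UnitAddTorus (Fin d) :=
  fun j => ((x j / (2 * Real.pi * s) : ℝ) : UnitAddCircle)

theorem continuous_torusProj (s : ℝ) : Continuous (torusProj (d := d) s) :=
  continuous_pi fun j => (AddCircle.continuous_mk' 1).comp (by fun_prop)

theorem fourier_torusProj (s : ℝ) (n : ℤ) (x : EuclideanSpace ℝ (Fin d)) (j : Fin d) :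
    fourier n (torusProj s x j) = Complex.exp (Complex.I * (n / s * x j : ℝ)) := by
  rw [torusProj, fourier_coe_apply]
  congr 1
  push_cast
  field_simp

theorem abs_arcsin_sin_le (θ : ℝ) : |Real.arcsin (Real.sin θ)| ≤ |θ| := by
  rcases le_total |θ| (Real.pi / 2) with h | h
  · rw [Real.arcsin_sin (abs_le.1 h).1 (abs_le.1 h).2]
  · exact (abs_le.2 ⟨Real.neg_pi_div_two_le_arcsin _, Real.arcsin_le_pi_div_two _⟩).trans h

/-- The map from the torus to `ℝ^d` whose pullback along `torusProj s` applies the triangle wave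
`t ↦ s arcsin (sin (t / s))` to each coordinate. -/
noncomputable def triangleWave (s : ℝ) : C(UnitAddTorus (Fin d), EuclideanSpace ℝ (Fin d)) where
  toFun y := WithLp.toLp 2 fun j => s * Real.arcsin (fourier 1 (y j)).im
  continuous_toFun := by
    have := Real.continuous_arcsin
    have := Complex.continuous_im
    fun_prop

theorem triangleWave_torusProj (s : ℝ) (x : EuclideanSpace ℝ (Fin d)) (j : Fin d) :
    triangleWave s (torusProj s x) j = s * Real.arcsin (Real.sin (x j / s)) := by
  change s * Real.arcsin (fourier 1 (torusProj s x j)).im = _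
  rw [fourier_torusProj, mul_comm Complex.I, Complex.exp_ofReal_mul_I_im, Int.cast_one,
    one_div_mul_eq_div]

theorem norm_triangleWave_torusProj_le {s : ℝ} (hs : 0 < s) (x : EuclideanSpace ℝ (Fin d)) :
    ‖triangleWave s (torusProj s x)‖ ≤ ‖x‖ := by
  simp only [EuclideanSpace.norm_eq, triangleWave_torusProj, Real.norm_eq_abs, abs_mul]
  gcongr with j
  calc |s| * |Real.arcsin (Real.sin (x j / s))| ≤ |s| * |x j / s| :=
        mul_le_mul_of_nonneg_left (abs_arcsin_sin_le _) (abs_nonneg s)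
    _ = |x j| := by rw [← abs_mul, mul_div_cancel₀ _ hs.ne']

theorem triangleWave_torusProj_of_norm_le {s : ℝ} (hs : 0 < s) {x : EuclideanSpace ℝ (Fin d)}
    (hx : ‖x‖ ≤ s) : triangleWave s (torusProj s x) = x := by
  ext j
  have hj : |x j / s| ≤ Real.pi / 2 := by
    rw [abs_div, abs_of_pos hs]
    exact (div_le_one_of_le₀ ((PiLp.norm_apply_le x j).trans hx) hs.le).trans
      Real.one_le_pi_div_two
  rw [triangleWave_torusProj, Real.arcsin_sin (abs_le.1 hj).1 (abs_le.1 hj).2,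
    mul_div_cancel₀ _ hs.ne']

end TriangleWave

namespace WeightedSpace

variable {d : ℕ} {ψ : ℝ≥0 → ℝ≥0}

theorem tendsto_exp_weight (hψ : Tendsto ψ atTop atTop) :
    Tendsto (fun r => Real.exp (ψ r)) atTop atTop :=
  Real.tendsto_exp_atTop.comp (NNReal.tendsto_coe_atTop.2 hψ)

theorem mem_weightedSubmodule_of_norm_le (hψ : Tendsto ψ atTop atTop)
    {f : EuclideanSpace ℝ (Fin d) → ℂ} (hf : Continuous f) {C : ℝ} (hC : ∀ x, ‖f x‖ ≤ C) :
    f ∈ weightedSubmodule d ψ := by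
  have hnorm : Tendsto (fun x : EuclideanSpace ℝ (Fin d) => ‖x‖₊) (Bornology.cobounded _) atTop :=
    NNReal.tendsto_coe_atTop.1 tendsto_norm_cobounded_atTop
  refine ⟨hf, squeeze_zero_norm (fun x => ?_)
    (((tendsto_exp_weight hψ).comp hnorm).const_div_atTop C)⟩
  rw [norm_div, Complex.norm_real, Real.norm_of_nonneg (Real.exp_pos _).le]
  exact div_le_div_of_nonneg_right (hC x) (Real.exp_pos _).le

theorem norm_le_of_forall_le_mul_exp (φ : WeightedSpace d ψ) {C : ℝ}
    (h : ∀ x, ‖toFunₗ d ψ φ x‖ ≤ C * Real.exp (ψ ‖x‖₊)) : ‖φ‖ ≤ C :=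
  ciSup_le fun x => (div_le_iff₀ (Real.exp_pos _)).2 (h x)

/-- The exponential `e_λ` as an element of `C_ψ(ℝ^d)`; it lies there because `ψ` tends to
infinity. -/
noncomputable def exponential (hψ : Tendsto ψ atTop atTop) (l : EuclideanSpace ℝ (Fin d)) :
    WeightedSpace d ψ :=
  ⟨expFun l,
    mem_weightedSubmodule_of_norm_le hψ (continuous_expFun l) fun x => (norm_expFun l x).le⟩

theorem toFunₗ_exponential (hψ : Tendsto ψ atTop atTop) (l : EuclideanSpace ℝ (Fin d)) :
    toFunₗ d ψ (exponential hψ l) = expFun l := rfl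

section Continuation

theorem toFunₗ_fwdDiff_iter_exponential (hψ : Tendsto ψ atTop atTop)
    (u l x : EuclideanSpace ℝ (Fin d)) (m : ℕ) :
    toFunₗ d ψ ((fwdDiff u)^[m] (exponential hψ) l) x = expFun l x * (expFun u x - 1) ^ m := by
  induction m generalizing l with
  | zero => simp [toFunₗ_exponential]
  | succ m ih =>
    rw [Function.iterate_succ_apply', fwdDiff, map_sub, Pi.sub_apply, ih, ih, expFun_add,
      Pi.mul_apply]
    ring

theorem norm_fwdDiff_iter_exponential_le (hψ : Tendsto ψ atTop atTop) (hψ_mono : Monotone ψ)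
    (u l : EuclideanSpace ℝ (Fin d)) (m : ℕ) (R : ℝ≥0) :
    ‖(fwdDiff u)^[m] (exponential hψ) l‖ ≤ (‖u‖ * R) ^ m + 2 ^ m * Real.exp (-ψ R) := by
  refine norm_le_of_forall_le_mul_exp _ fun x => ?_
  rw [toFunₗ_fwdDiff_iter_exponential, norm_mul, norm_expFun, one_mul, norm_pow, add_mul]
  rcases le_total ‖x‖₊ R with hx | hx
  · calc ‖expFun u x - 1‖ ^ m ≤ (‖u‖ * R) ^ m := by
          gcongr
          exact (norm_expFun_sub_one_le u x).trans (by gcongr; exact hx)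
      _ ≤ (‖u‖ * R) ^ m * Real.exp (ψ ‖x‖₊) :=
          le_mul_of_one_le_right (by positivity) (Real.one_le_exp (ψ ‖x‖₊).2)
      _ ≤ _ := le_add_of_nonneg_right (by positivity)
  · calc ‖expFun u x - 1‖ ^ m ≤ 2 ^ m := by
          gcongr
          exact norm_expFun_sub_one_le_two u x
      _ ≤ 2 ^ m * Real.exp (-ψ R + ψ ‖x‖₊) :=
          le_mul_of_one_le_right (by positivity) (Real.one_le_exp (by
            simpa using hψ_mono hx))
      _ = 2 ^ m * Real.exp (-ψ R) * Real.exp (ψ ‖x‖₊) := by rw [Real.exp_add, mul_assoc]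
      _ ≤ _ := le_add_of_nonneg_left (by positivity)

variable (p : Seminorm ℂ (WeightedSpace d ψ)) {c : EuclideanSpace ℝ (Fin d)}

theorem seminorm_exponential_extrapolate (hp : ∀ φ, p φ ≤ ‖φ‖) (hψ : Tendsto ψ atTop atTop)
    (hψ_mono : Monotone ψ) {n : ℕ} (hn : n ≠ 0) {R : ℝ≥0} {ρ σ B : ℝ} (hρ : 0 < ρ) (hσ : 0 ≤ σ)
    (hσρ : σ ≤ 2 * ρ) (hσR : σ / n * R ≤ 1)
    (hB : ∀ l ∈ Metric.closedBall c ρ, p (exponential hψ l) ≤ B) :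
    ∀ l ∈ Metric.closedBall c (ρ + σ), p (exponential hψ l) ≤
      4 ^ n * ((σ / n * R) ^ n + 4 ^ n * Real.exp (-ψ R) + 2 ^ n * B) := by
  intro l hl
  obtain ⟨u, hu, hmem⟩ := exists_norm_le_forall_add_nsmul_mem_closedBall hρ hσ hσρ hl hn
  refine seminorm_le_of_fwdDiff_iter_le p _ u l (fun k hk => ?_)
    fun k hk hk' => hB _ (hmem k hk hk')
  calc _ ≤ (‖u‖ * R) ^ (2 * n - k) + 2 ^ (2 * n - k) * Real.exp (-ψ R) :=
        (hp _).trans (norm_fwdDiff_iter_exponential_le hψ hψ_mono u _ _ R)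
    _ ≤ (σ / n * R) ^ (2 * n - k) + 2 ^ (2 * n) * Real.exp (-ψ R) := by
        gcongr <;> [norm_num; lia]
    _ ≤ (σ / n * R) ^ n + 4 ^ n * Real.exp (-ψ R) := by
        gcongr ?_ + ?_ * _
        · exact pow_le_pow_of_le_one (by positivity) hσR (by lia)
        · rw [pow_mul]
          norm_num

theorem seminorm_exponential_le_inv_pow_of_closedBall (hp : ∀ φ, p φ ≤ ‖φ‖)
    (hψ : Tendsto ψ atTop atTop) (hψ_mono : Monotone ψ) {m : ℕ} (hm : m ≠ 0) {R : ℝ≥0}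
    (hψR : 20 * m ≤ ψ R) {ρ σ : ℝ} (hρ : 0 < ρ) (hσ : 0 ≤ σ) (hσρ : σ ≤ 2 * ρ)
    (hσR : 4 * (σ * R) ≤ m)
    (hB : ∀ l ∈ Metric.closedBall c ρ, p (exponential hψ l) ≤ 64⁻¹ ^ (4 * m)) :
    ∀ l ∈ Metric.closedBall c (ρ + σ), p (exponential hψ l) ≤ 64⁻¹ ^ m := by
  have hstep : σ / (4 * m : ℕ) * R ≤ 16⁻¹ := by
    push_cast
    rw [div_mul_eq_mul_div, div_le_iff₀ (by positivity)]
    linarith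
  have hexp : Real.exp (-ψ R) ≤ 64⁻¹ ^ (4 * m) := exp_neg_le_inv_sixtyFour_pow (by
    have : (20 * m : ℝ) ≤ ψ R := by exact_mod_cast hψR
    push_cast
    linarith)
  -- With `n = 4 * m` nodes each error term is at most `16⁻¹ ^ n`, which beats the factor `4 ^ n`.
  have h₁₆ : (4 : ℝ) ^ (4 * m) * 16⁻¹ ^ (4 * m) = 256⁻¹ ^ m := by
    rw [← mul_pow, pow_mul]
    norm_num
  have h₆₄ : (4 : ℝ) ^ (4 * m) * (4 ^ (4 * m) * 64⁻¹ ^ (4 * m)) = 256⁻¹ ^ m := by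
    rw [← mul_pow, ← mul_pow, pow_mul]
    norm_num
  intro l hl
  calc p (exponential hψ l) ≤ _ := seminorm_exponential_extrapolate p hp hψ hψ_mono (n := 4 * m)
        (by positivity) hρ hσ hσρ (hstep.trans (by norm_num)) hB l hl
    _ ≤ 4 ^ (4 * m) * (16⁻¹ ^ (4 * m) + 4 ^ (4 * m) * 64⁻¹ ^ (4 * m) +
          4 ^ (4 * m) * 64⁻¹ ^ (4 * m)) := by
        gcongr
        norm_num
    _ = 3 * 256⁻¹ ^ m := by
        rw [mul_add, mul_add, h₁₆, h₆₄]
        ring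
    _ ≤ 4 ^ m * 256⁻¹ ^ m := by
        gcongr
        calc (3 : ℝ) ≤ 4 ^ 1 := by norm_num
          _ ≤ 4 ^ m := by gcongr <;> [norm_num; lia]
    _ = 64⁻¹ ^ m := by rw [← mul_pow]; norm_num

theorem seminorm_exponential_le_inv_pow_pow (hp : ∀ φ, p φ ≤ ‖φ‖) (hψ : Tendsto ψ atTop atTop)
    (hψ_mono : Monotone ψ) {R : ℕ → ℝ≥0} (hψR : ∀ k, 20 * 4 ^ k ≤ ψ (R k)) {a : ℝ} (ha : 0 < a)
    (hzero : ∀ l ∈ Metric.closedBall c a, p (exponential hψ l) = 0) (j k : ℕ) :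
    ∀ l ∈ Metric.closedBall c
        (a + ∑ i ∈ Finset.range j, min ((4 : ℝ) ^ (k + i) / R (k + i) / 4) a),
      p (exponential hψ l) ≤ 64⁻¹ ^ 4 ^ k := by
  induction j generalizing k with
  | zero =>
    intro l hl
    rw [hzero l (by simpa using hl)]
    positivity
  | succ j ih =>
    have hsum : 0 ≤ ∑ i ∈ Finset.range j, min ((4 : ℝ) ^ (k + 1 + i) / R (k + 1 + i) / 4) a :=
      Finset.sum_nonneg fun i _ => by positivity
    have hmin : min ((4 : ℝ) ^ k / R k / 4) a * R k ≤ 4 ^ k / 4 :=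
      mul_le_of_le_div₀ (by positivity) (by positivity)
        ((min_le_left _ _).trans_eq (div_right_comm _ _ _))
    intro l hl
    simp only [Finset.sum_range_succ', add_zero, ← add_assoc, add_right_comm k _ 1] at hl
    refine seminorm_exponential_le_inv_pow_of_closedBall p hp hψ hψ_mono (m := 4 ^ k) (R := R k)
      (by positivity) (by exact_mod_cast hψR k) (by positivity) (by positivity)
      ((min_le_right _ _).trans (by linarith)) (by push_cast; linarith) ?_ l hl
    rw [← pow_succ']
    exact ih (k + 1)

theorem seminorm_exponential_eq_zero (hp : ∀ φ, p φ ≤ ‖φ‖) (hψ : Tendsto ψ atTop atTop)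
    (hψ_mono : Monotone ψ) {R : ℕ → ℝ≥0} (hψR : ∀ k, 20 * 4 ^ k ≤ ψ (R k))
    (hR : ¬ Summable fun k => (4 : ℝ) ^ k / R k) {a : ℝ} (ha : 0 < a)
    (hzero : ∀ l ∈ Metric.closedBall c a, p (exponential hψ l) = 0)
    (l : EuclideanSpace ℝ (Fin d)) : p (exponential hψ l) = 0 := by
  have hgain (k : ℕ) : ¬ Summable fun i => min ((4 : ℝ) ^ (k + i) / R (k + i) / 4) a := by
    refine not_summable_min_const ha fun hsum => hR ?_
    refine (summable_nat_add_iff k).1 ((hsum.mul_left 4).congr fun i => ?_)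
    rw [add_comm k, mul_div_cancel₀ _ four_ne_zero]
  have hsmall (k : ℕ) : p (exponential hψ l) ≤ 64⁻¹ ^ 4 ^ k := by
    obtain ⟨j, hj⟩ := (((not_summable_iff_tendsto_nat_atTop_of_nonneg fun i => by positivity).1
      (hgain k)).eventually_ge_atTop (dist l c)).exists
    exact seminorm_exponential_le_inv_pow_pow p hp hψ hψ_mono hψR ha hzero j k l
      (Metric.mem_closedBall.2 (by linarith))
  have hlim : Tendsto (fun k : ℕ => (64⁻¹ : ℝ) ^ 4 ^ k) atTop (𝓝 0) :=
    (tendsto_pow_atTop_nhds_zero_of_lt_one (by norm_num) (by norm_num)).comp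
      (tendsto_pow_atTop_atTop_of_one_lt (by norm_num))
  exact le_antisymm (ge_of_tendsto' hlim hsmall) (apply_nonneg p _)

theorem exponential_mem_topologicalClosure (hψ : Tendsto ψ atTop atTop) (hψ_mono : Monotone ψ)
    {R : ℕ → ℝ≥0} (hψR : ∀ k, 20 * 4 ^ k ≤ ψ (R k))
    (hR : ¬ Summable fun k => (4 : ℝ) ^ k / R k) {U : Set (EuclideanSpace ℝ (Fin d))}
    (hU : (interior U).Nonempty) {N : Submodule ℂ (WeightedSpace d ψ)}
    (hUN : ∀ l ∈ U, exponential hψ l ∈ N) (l : EuclideanSpace ℝ (Fin d)) :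
    exponential hψ l ∈ N.topologicalClosure := by
  obtain ⟨c, hc⟩ := hU
  obtain ⟨a, ha, haU⟩ := Metric.nhds_basis_closedBall.mem_iff.1 (mem_interior_iff_mem_nhds.1 hc)
  let p : Seminorm ℂ (WeightedSpace d ψ) := (normSeminorm ℂ (WeightedSpace d ψ ⧸ N)).comp N.mkQ
  have hp (φ : WeightedSpace d ψ) : p φ = 0 ↔ φ ∈ N.topologicalClosure :=
    QuotientAddGroup.norm_mk_eq_zero_iff_mem_closure (S := N.toAddSubgroup)
  exact (hp _).1 <| seminorm_exponential_eq_zero p (Submodule.Quotient.norm_mk_le N) hψ hψ_mono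
    hψR hR ha (fun l hl => (hp _).2 (N.le_topologicalClosure (hUN l (haU hl)))) l

end Continuation

section TrigonometricApproximation

/-- The pullback along `torusProj s` of continuous functions on the torus, as elements of
`C_ψ(ℝ^d)`. -/
noncomputable def torusPullback (hψ : Tendsto ψ atTop atTop) (s : ℝ) :
    C(UnitAddTorus (Fin d), ℂ) →L[ℂ] WeightedSpace d ψ :=
  LinearMap.mkContinuous
    { toFun := fun F => ⟨F ∘ torusProj s, mem_weightedSubmodule_of_norm_le hψ
        (F.continuous.comp (continuous_torusProj s)) fun _ => F.norm_coe_le_norm _⟩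
      map_add' := fun _ _ => rfl
      map_smul' := fun _ _ => rfl } 1
    fun F => norm_le_of_forall_le_mul_exp _ fun x => by
      rw [one_mul]
      exact (F.norm_coe_le_norm _).trans
        (le_mul_of_one_le_right (norm_nonneg F) (Real.one_le_exp (ψ ‖x‖₊).2))

theorem toFunₗ_torusPullback (hψ : Tendsto ψ atTop atTop) (s : ℝ)
    (F : C(UnitAddTorus (Fin d), ℂ)) (x : EuclideanSpace ℝ (Fin d)) :
    toFunₗ d ψ (torusPullback hψ s F) x = F (torusProj s x) := rfl

theorem torusPullback_mFourier (hψ : Tendsto ψ atTop atTop) (s : ℝ) (n : Fin d → ℤ) :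
    torusPullback hψ s (UnitAddTorus.mFourier n) =
      exponential hψ (WithLp.toLp 2 fun j => n j / s) := by
  refine Subtype.ext (funext fun x => ?_)
  change ∏ j, fourier (n j) (torusProj s x j) = expFun _ x
  simp only [fourier_torusProj, ← Complex.exp_sum, expFun, ← Finset.mul_sum, ← Complex.ofReal_sum,
    PiLp.inner_apply, RCLike.inner_apply, conj_trivial, mul_comm]

theorem torusPullback_mem_topologicalClosure_span (hψ : Tendsto ψ atTop atTop) (s : ℝ)
    (F : C(UnitAddTorus (Fin d), ℂ)) :
    torusPullback hψ s F ∈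
      (Submodule.span ℂ (Set.range (exponential (d := d) hψ))).topologicalClosure := by
  have hF : F ∈ (Submodule.span ℂ (Set.range UnitAddTorus.mFourier)).topologicalClosure := by
    rw [UnitAddTorus.span_mFourier_closure_eq_top]
    trivial
  refine Submodule.topologicalClosure_mono ?_
    (Submodule.topologicalClosure_map _ _ (Submodule.mem_map_of_mem hF))
  rw [Submodule.map_span, Submodule.span_le]
  rintro _ ⟨_, ⟨n, rfl⟩, rfl⟩
  exact Submodule.subset_span ⟨_, (torusPullback_mFourier hψ s n).symm⟩

theorem exists_forall_norm_le_add_mul_exp (φ : WeightedSpace d ψ) {ε : ℝ} (hε : 0 < ε) :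
    ∃ C, ∀ x, ‖toFunₗ d ψ φ x‖ ≤ C + ε * Real.exp (ψ ‖x‖₊) := by
  obtain ⟨hφ, hlim⟩ := φ.2
  have hfar : ∀ᶠ x in Filter.cocompact (EuclideanSpace ℝ (Fin d)),
      ‖toFunₗ d ψ φ x‖ < ε * Real.exp (ψ ‖x‖₊) := by
    rw [← Metric.cobounded_eq_cocompact]
    filter_upwards [(tendsto_zero_iff_norm_tendsto_zero.1 hlim).eventually_lt_const hε] with x hx
    rwa [norm_div, Complex.norm_real, Real.norm_of_nonneg (Real.exp_pos _).le,
      div_lt_iff₀ (Real.exp_pos _)] at hx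
  obtain ⟨K, hK, hKφ⟩ := Filter.hasBasis_cocompact.eventually_iff.1 hfar
  obtain ⟨C, hC⟩ := hK.exists_bound_of_continuousOn hφ.continuousOn
  refine ⟨max C 0, fun x => ?_⟩
  by_cases hx : x ∈ K
  · exact ((hC x hx).trans (le_max_left _ _)).trans (le_add_of_nonneg_right (by positivity))
  · exact (hKφ hx).le.trans (le_add_of_nonneg_left (le_max_right _ _))

theorem exists_norm_sub_torusPullback_le (hψ : Tendsto ψ atTop atTop) (hψ_mono : Monotone ψ)
    (φ : WeightedSpace d ψ) {ε : ℝ} (hε : 0 < ε) :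
    ∃ s F, ‖φ - torusPullback hψ s F‖ ≤ 4 * ε := by
  obtain ⟨C, hC⟩ := exists_forall_norm_le_add_mul_exp φ hε
  obtain ⟨s, hCs, hs⟩ := (((tendsto_exp_weight hψ).eventually_ge_atTop (C / ε)).and
    (eventually_gt_atTop 0)).exists
  let F : C(UnitAddTorus (Fin d), ℂ) :=
    (⟨toFunₗ d ψ φ, φ.2.1⟩ : C(EuclideanSpace ℝ (Fin d), ℂ)).comp (triangleWave s)
  refine ⟨s, F, norm_le_of_forall_le_mul_exp _ fun x => ?_⟩
  rw [map_sub, Pi.sub_apply, toFunₗ_torusPullback]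
  change ‖toFunₗ d ψ φ x - toFunₗ d ψ φ (triangleWave s (torusProj s x))‖ ≤ _
  rcases le_total ‖x‖₊ s with hx | hx
  · rw [triangleWave_torusProj_of_norm_le (NNReal.coe_pos.2 hs) hx, sub_self, norm_zero]
    positivity
  · have hCx : C ≤ ε * Real.exp (ψ ‖x‖₊) := by
      rw [div_le_iff₀' hε] at hCs
      exact hCs.trans (by gcongr; exact hψ_mono hx)
    have hwave : Real.exp (ψ ‖triangleWave s (torusProj s x)‖₊) ≤ Real.exp (ψ ‖x‖₊) :=
      Real.exp_le_exp.2 (hψ_mono (norm_triangleWave_torusProj_le (NNReal.coe_pos.2 hs) x))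
    calc _ ≤ ‖toFunₗ d ψ φ x‖ + ‖toFunₗ d ψ φ (triangleWave s (torusProj s x))‖ :=
          norm_sub_le _ _
      _ ≤ (C + ε * Real.exp (ψ ‖x‖₊)) + (C + ε * Real.exp (ψ ‖x‖₊)) :=
          add_le_add (hC x) ((hC _).trans (by gcongr))
      _ ≤ 4 * ε * Real.exp (ψ ‖x‖₊) := by linarith

theorem topologicalClosure_span_range_exponential (hψ : Tendsto ψ atTop atTop)
    (hψ_mono : Monotone ψ) :
    (Submodule.span ℂ (Set.range (exponential (d := d) hψ))).topologicalClosure = ⊤ := by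
  refine Submodule.eq_top_iff'.2 fun φ => ?_
  rw [← SetLike.mem_coe, ← (Submodule.isClosed_topologicalClosure _).closure_eq]
  refine Metric.mem_closure_iff.2 fun ε hε => ?_
  obtain ⟨s, F, hF⟩ := exists_norm_sub_torusPullback_le hψ hψ_mono φ (ε := ε / 8) (by positivity)
  exact ⟨_, torusPullback_mem_topologicalClosure_span hψ s F, by rw [dist_eq_norm]; linarith⟩

end TrigonometricApproximation

end WeightedSpace

theorem lemma2p2_general {d : ℕ} {ψ : ℝ≥0 → ℝ≥0} (hψ_mono : Monotone ψ)
    (hψ_int : ∫⁻ r in Set.Ioi (1 : ℝ), ENNReal.ofReal ((ψ r.toNNReal : ℝ) / r ^ 2) = ⊤)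
    {U : Set (EuclideanSpace ℝ (Fin d))} (hU : (interior U).Nonempty) :
    Submodule.span ℂ (expFun '' U) ≤ weightedSubmodule d ψ ∧
      Dense (((Submodule.span ℂ (expFun '' U)).comap (WeightedSpace.toFunₗ d ψ) :
        Submodule ℂ (WeightedSpace d ψ)) : Set (WeightedSpace d ψ)) := by
  have hψ := tendsto_atTop_of_lintegral_div_sq_eq_top hψ_mono hψ_int
  obtain ⟨R, hψR, hR⟩ := exists_seq_le_not_summable_pow_div hψ_mono hψ_int
    (b := 20) (q := 4) (by norm_num) (by norm_num)
  constructor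
  · rw [Submodule.span_le]
    rintro _ ⟨l, -, rfl⟩
    exact (WeightedSpace.exponential hψ l).2
  · rw [Submodule.dense_iff_topologicalClosure_eq_top, eq_top_iff,
      ← WeightedSpace.topologicalClosure_span_range_exponential hψ hψ_mono]
    refine Submodule.topologicalClosure_minimal _ (Submodule.span_le.2 ?_)
      (Submodule.isClosed_topologicalClosure _)
    rintro _ ⟨l, rfl⟩
    refine WeightedSpace.exponential_mem_topologicalClosure hψ hψ_mono hψR hR hU (fun m hm => ?_) l
    exact Submodule.mem_comap.2 (Submodule.subset_span ⟨m, hm, rfl⟩)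

/-- If `ψ : [0,∞) → [0,∞)` is increasing, tends to infinity and `∫₁^∞ ψ(r)/r² dr = ∞`, then
`Φ_L(ℝ^d)` is a dense linear subspace of `(C_ψ(ℝ^d), ‖·‖_ψ)` for every `L > 0`. -/
theorem lemma2p2 (d : ℕ) (hd : 1 ≤ d) (ψ : ℝ≥0 → ℝ≥0) (hψ_mono : Monotone ψ)
    (hψ_lim : Tendsto ψ atTop atTop)
    (hψ_int : ∫⁻ r in Set.Ioi (1 : ℝ), ENNReal.ofReal ((ψ r.toNNReal : ℝ) / r ^ 2) = ⊤)
    (L : ℝ) (hL : 0 < L) :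
    expSpan d L ≤ weightedSubmodule d ψ ∧
      Dense (((expSpan d L).comap (WeightedSpace.toFunₗ d ψ) :
        Submodule ℂ (WeightedSpace d ψ)) : Set (WeightedSpace d ψ)) :=
  lemma2p2_general hψ_mono hψ_int ⟨0, mem_interior_iff_mem_nhds.2 (openCube_mem_nhds_zero hL)⟩
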